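/- Let $\alpha>0$ and $Re>0$. Let $U\in C^2([-1,1];\mathbb R)$ be a base velocity profile and let $m:[0,\infty)\to\mathbb R$ be a shear-thinning viscosity law, i.e. non-increasing on $[0,\infty)$ and differentiable on $(0,\infty)$. Let $$\mu(y)=m(|U'(y)|),\qquad \mu_t(y)=m(|U'(y)|)+m'(|U'(y)|)\,|U'(y)|$$ be the effective and the tangent viscosity along the flow (the product $m'(\gamma)\gamma$ being $0$ at $\gamma=0$), and assume that $\mu,\mu_t\in C^2([-1,1])$ and $\mu_t>0$ on $[-1,1]$. With $D=d/dy$, let $$\mathcal L v=\alpha\big[U(D^2-\alpha^2)v-U''v\big]+\frac{i}{Re}\big[\mu(D^2-\alpha^2)^2v+2\mu'D^3v+\mu''D^2v-2\alpha^2\mu'Dv+\alpha^2\mu''v\big]+\frac{i}{Re}(D^2+\alpha^2)\big[(\mu_t-\mu)(D^2+\alpha^2)v\big]$$ be the modified Orr–Sommerfeld operator. A number $c=c_r+ic_i\in\mathbb C$ is an eigenvalue if there is $v\in C^4([-1,1];\mathbb C)$, $v\not\equiv0$, with $$\tfrac1\alpha\mathcal L v=c\,(D^2-\alpha^2)v \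 \text{ on } (-1,1),\qquad v(\pm1)=v'(\pm1)=0.$$ All maxima and minima being taken over $[-1,1]$, write $q=\max|U'|$, $p=\min\mu_t$, $U_{\min}=\min U$, $U_{\max}=\max U$, $U''_{\min}=\min U''$, $U''_{\max}=\max U''$. Then: 1. Every eigenvalue satisfies $$c_i\le\frac{q}{2\alpha}-\frac{p}{\alpha Re}\left(\frac{\pi^2(\pi^2+\alpha^2)}{\pi^2+4\alpha^2}+\alpha^2\right).$$ 2. With $\lambda_3=(2.365)^2$ (the clamped vibrating-rod constant), if $$q\,\alpha Re<p\cdot\max\big(\lambda_3\pi+2^{3/2}\alpha^3,\ \lambda_3\pi+\pi\alpha^2\big),$$ then there is no eigenvalue with $c_i>0$. 3. If $U$ is not constant on $[-1,1]$, then every eigenvalue satisfies - if $U''_{\min}\ge0$: $\quad U_{\min}<c_r<U_{\max}+\dfrac{2U''_{\max}}{\pi^2+4\alpha^2}$; - if $U''_{\min}\le0\le U''_{\max}$: $\quad U_{\min}+\dfrac{2U''_{\min}}{\pi^2+4\alpha^2}<c_r<U_{\max}+\dfrac{2U''_{\max}}{\pi^2+4\alpha^2}$; - if $U''_{\max}\le0$: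 $\quad U_{\min}+\dfrac{2U''_{\min}}{\pi^2+4\alpha^2}<c_r<U_{\max}$. -/

import Mathlib

open Set

namespace OrrSommerfeld

noncomputable section

/-- The channel cross-section `[-1, 1]`. -/
def channel : Set ℝ := Icc (-1) 1

/-- Differentiation `D = d/dy` of functions on the channel (one-sided at the walls). -/
def D {F : Type*} [NormedAddCommGroup F] [NormedSpace ℝ F] (f : ℝ → F) : ℝ → F :=
  derivWithin f channel

/-- Maximum over the channel (the theorem uses it for continuous functions only). -/
def maxCh (f : ℝ → ℝ) : ℝ := sSup (f '' channel)

/-- Minimum over the channel (the theorem uses it for continuous functions only). -/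
def minCh (f : ℝ → ℝ) : ℝ := sInf (f '' channel)

/-- The effective viscosity `μ(y) = m(γ)` along the base flow `U`, where `γ = |U'(y)|` is the
shear rate and `m` the viscosity law. -/
def effViscosity (m : ℝ → ℝ) (U : ℝ → ℝ) (y : ℝ) : ℝ := m |D U y|

/-- The tangent viscosity `μ_t(y) = m(γ) + m'(γ) γ` at `γ = |U'(y)|`. -/
def tanViscosity (m : ℝ → ℝ) (U : ℝ → ℝ) (y : ℝ) : ℝ :=
  m |D U y| + deriv m |D U y| * |D U y|

/-- The anisotropic stress factor `(μ_t - μ) (D² + α²) v`. -/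
def stressFactor (α : ℝ) (μ μt : ℝ → ℝ) (v : ℝ → ℂ) (y : ℝ) : ℂ :=
  ((μt y - μ y : ℝ) : ℂ) * (D^[2] v y + (α : ℂ) ^ 2 * v y)

/-- The modified Orr–Sommerfeld operator for two-dimensional (spanwise homogeneous)
perturbations of wave number `α`; here `(D² - α²)² v = D⁴ v - 2 α² D² v + α⁴ v`. -/
def orrSommerfeldOp (α Re : ℝ) (U μ μt : ℝ → ℝ) (v : ℝ → ℂ) (y : ℝ) : ℂ :=
  (α : ℂ) * ((U y : ℂ) * (D^[2] v y - (α : ℂ) ^ 2 * v y) - ((D^[2] U y : ℝ) : ℂ) * v y)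
  + Complex.I / (Re : ℂ) *
      ((μ y : ℂ) * (D^[4] v y - 2 * (α : ℂ) ^ 2 * D^[2] v y + (α : ℂ) ^ 4 * v y)
        + 2 * ((D μ y : ℝ) : ℂ) * D^[3] v y
        + ((D^[2] μ y : ℝ) : ℂ) * D^[2] v y
        - 2 * (α : ℂ) ^ 2 * ((D μ y : ℝ) : ℂ) * D v y
        + (α : ℂ) ^ 2 * ((D^[2] μ y : ℝ) : ℂ) * v y)
  + Complex.I / (Re : ℂ) *
      (D^[2] (stressFactor α μ μt v) y + (α : ℂ) ^ 2 * stressFactor α μ μt v y)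

/-- `c` is an eigenvalue of `α⁻¹ L v = c (D² - α²) v` with `v(±1) = v'(±1) = 0`. -/
def IsEigenvalue (α Re : ℝ) (U μ μt : ℝ → ℝ) (c : ℂ) : Prop :=
  ∃ v : ℝ → ℂ, ContDiffOn ℝ 4 v channel ∧ (∃ y ∈ channel, v y ≠ 0) ∧
    v (-1) = 0 ∧ v 1 = 0 ∧ D v (-1) = 0 ∧ D v 1 = 0 ∧
    ∀ y ∈ Ioo (-1 : ℝ) 1,
      (1 / (α : ℂ)) * orrSommerfeldOp α Re U μ μt v y
        = c * (D^[2] v y - (α : ℂ) ^ 2 * v y)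

/-- The clamped vibrating-rod constant. -/
def rodConst : ℝ := 2.365 ^ 2

end

end OrrSommerfeld

open OrrSommerfeld

/-!
The proof is the energy method. With `F = μ_t (D² + α²) v`, the viscous part of the operator is
`(i/Re) [(D² + α²) F - 4 α² (μ v')']`, so testing the eigenvalue equation against `conj v` and
integrating by parts over the channel (`ClampedMode.exists_primitive`) gives
`c ∫ e = ∫ U e - ∫ U' v conj v' - (i / (α Re)) ∫ (μ_t |v'' + α² v|² + 4 α² μ |v'|²)`,
where `e = |v'|² + α² |v|²`.

The imaginary part balances production against dissipation. The production is at most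
`q ∫ |v| |v'|`. Shear thinning gives `μ_t ≤ μ`, so the dissipation is at least
`p (‖v''‖² + 2 α² ‖v'‖² + α⁴ ‖v‖²)`. The bounds on the growth rate (`ClampedMode.im_le`,
`ClampedMode.im_nonpos`) then follow from three inequalities on `[-1, 1]`:
`(π/2)² ‖v‖² ≤ ‖v'‖²`, `π² ‖v'‖² ≤ ‖v''‖²` and `2.365⁴ ‖v‖² ≤ ‖v''‖²`
(`poincare_inequality`, `buckling_inequality`, `rod_inequality`). Each is proved by completing a
square: the difference of the two sides is the integral of a square, `‖v'' + a v' + b v‖²` for the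
last two, with `a` and `b` built from the Wronskian of two solutions of the Euler–Lagrange equation
(`jacobi_wronskian`). The one analytic input is that this Wronskian has no zero on the interval; for
the rod it is `1 - cos s cosh s`, whose first positive zero `4.73004…` barely exceeds `2 · 2.365`.

The real part reads `c_r ∫ e = ∫ U e + ½ ∫ U'' |v|²`, and the bounds on the wave speed
(`ClampedMode.re_lt`, `ClampedMode.lt_re`) follow from `U_min ≤ U ≤ U_max` and the Poincaré
inequality. They are strict because `e` cannot vanish on the open set where `U` differs from its
extreme value: since `μ_t > 0`, the equation can be solved for `v''''`, and Grönwall's inequality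
would force `v = 0` everywhere (`ClampedMode.integral_weight_pos`).
-/

namespace OrrSommerfeld

/-! ### Calculus on the channel -/

/-- `f'` is the derivative of `f` on the channel, one-sided at the walls. -/
def DerivOn {F : Type*} [NormedAddCommGroup F] [NormedSpace ℝ F] (f f' : ℝ → F) : Prop :=
  ∀ y ∈ channel, HasDerivWithinAt f (f' y) channel y

section Calculus

variable {F : Type*} [NormedAddCommGroup F] [NormedSpace ℝ F]

theorem uniqueDiffOn_channel : UniqueDiffOn ℝ channel :=
  uniqueDiffOn_Icc (by norm_num)

theorem isCompact_channel : IsCompact channel := isCompact_Icc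

theorem nonempty_channel : channel.Nonempty := ⟨0, by constructor <;> norm_num⟩

theorem left_mem_channel : (-1 : ℝ) ∈ channel := by constructor <;> norm_num

theorem Ioo_subset_channel : Ioo (-1 : ℝ) 1 ⊆ channel := Ioo_subset_Icc_self

theorem channel_mem_nhds {y : ℝ} (hy : y ∈ Ioo (-1 : ℝ) 1) : channel ∈ nhds y :=
  Icc_mem_nhds hy.1 hy.2

theorem DerivOn.continuousOn {f f' : ℝ → F} (h : DerivOn f f') : ContinuousOn f channel :=
  fun y hy => (h y hy).continuousWithinAt

theorem DerivOn.D_eq {f f' : ℝ → F} (h : DerivOn f f') {y : ℝ} (hy : y ∈ channel) :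
    D f y = f' y :=
  (h y hy).derivWithin (uniqueDiffOn_channel y hy)

theorem DerivOn.iterate_D_two_eq {f f' f'' : ℝ → F} (h : DerivOn f f') (h' : DerivOn f' f'')
    {y : ℝ} (hy : y ∈ channel) : D^[2] f y = f'' y := by
  have : D (D f) y = D f' y := derivWithin_congr (fun z hz => h.D_eq hz) (h.D_eq hy)
  exact this.trans (h'.D_eq hy)

theorem contDiffOn_iterate_D {f : ℝ → F} (k n : ℕ) (hf : ContDiffOn ℝ (n + k : ℕ) f channel) :
    ContDiffOn ℝ n (D^[k] f) channel := by
  induction k generalizing n with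
  | zero => simpa using hf
  | succ k ih =>
    rw [Function.iterate_succ_apply']
    refine (ih (n + 1) (by rwa [add_right_comm, add_assoc])).derivWithin uniqueDiffOn_channel ?_
    norm_cast

theorem derivOn_iterate_D {f : ℝ → F} {k n : ℕ} (hf : ContDiffOn ℝ n f channel) (hk : k < n) :
    DerivOn (D^[k] f) (D^[k + 1] f) := by
  intro y hy
  have h1 : ContDiffOn ℝ 1 (D^[k] f) channel := by
    refine contDiffOn_iterate_D k 1 (hf.of_le ?_)
    norm_cast; omega
  rw [Function.iterate_succ_apply']
  exact ((h1.differentiableOn one_ne_zero) y hy).hasDerivWithinAt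

theorem continuousOn_iterate_D {f : ℝ → F} {k n : ℕ} (hf : ContDiffOn ℝ n f channel)
    (hk : k ≤ n) : ContinuousOn (D^[k] f) channel := by
  refine (contDiffOn_iterate_D k 0 (hf.of_le ?_)).continuousOn
  norm_cast; omega

omit [NormedSpace ℝ F] in
theorem intervalIntegrable_channel {f : ℝ → F} (hf : ContinuousOn f channel) :
    IntervalIntegrable f MeasureTheory.volume (-1) 1 :=
  ContinuousOn.intervalIntegrable_of_Icc (by norm_num) hf

/-- The derivative of a function vanishing at both walls has integral zero. -/
theorem DerivOn.integral_eq_zero [CompleteSpace F] {f f' : ℝ → F} (h : DerivOn f f')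
    (hc : ContinuousOn f' channel) (hl : f (-1) = 0) (hr : f 1 = 0) :
    ∫ y in (-1 : ℝ)..1, f' y = 0 := by
  rw [intervalIntegral.integral_eq_sub_of_hasDerivAt_of_le (by norm_num) h.continuousOn
    (fun y hy => (h y (Ioo_subset_channel hy)).hasDerivAt (channel_mem_nhds hy))
    (intervalIntegrable_channel hc), hl, hr, sub_zero]

theorem integral_channel_mono {f g : ℝ → ℝ} (hf : ContinuousOn f channel)
    (hg : ContinuousOn g channel) (h : ∀ y ∈ channel, f y ≤ g y) :
    ∫ y in (-1 : ℝ)..1, f y ≤ ∫ y in (-1 : ℝ)..1, g y :=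
  intervalIntegral.integral_mono_on (by norm_num) (intervalIntegrable_channel hf)
    (intervalIntegrable_channel hg) h

theorem integral_channel_pos {f : ℝ → ℝ} (hf : ContinuousOn f channel)
    (h : ∀ y ∈ channel, 0 ≤ f y) (hpos : ∃ y ∈ channel, 0 < f y) :
    0 < ∫ y in (-1 : ℝ)..1, f y :=
  intervalIntegral.integral_pos (by norm_num) hf
    (fun y hy => h y (Ioc_subset_Icc_self hy)) hpos

theorem le_maxCh {f : ℝ → ℝ} (hf : ContinuousOn f channel) {y : ℝ} (hy : y ∈ channel) :
    f y ≤ maxCh f :=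
  le_csSup (isCompact_channel.bddAbove_image hf) (mem_image_of_mem f hy)

theorem minCh_le {f : ℝ → ℝ} (hf : ContinuousOn f channel) {y : ℝ} (hy : y ∈ channel) :
    minCh f ≤ f y :=
  csInf_le (isCompact_channel.bddBelow_image hf) (mem_image_of_mem f hy)

theorem minCh_pos {f : ℝ → ℝ} (hf : ContinuousOn f channel) (h : ∀ y ∈ channel, 0 < f y) :
    0 < minCh f := by
  obtain ⟨y, hy, hy'⟩ := isCompact_channel.exists_sInf_image_eq nonempty_channel hf
  rw [minCh, hy']
  exact h y hy

end Calculus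

/-! ### Sharp Poincaré-type inequalities -/

section Poincare

variable {E : Type*} [NormedAddCommGroup E] [InnerProductSpace ℝ E]

open scoped InnerProductSpace

omit [InnerProductSpace ℝ E] in
theorem integral_norm_sq_nonneg (f : ℝ → E) : 0 ≤ ∫ y in (-1 : ℝ)..1, ‖f y‖ ^ 2 :=
  intervalIntegral.integral_nonneg (by norm_num) fun _ _ => by positivity

/-- The factorizations below degenerate at the optimal constant `c`, which is therefore approached
from below. -/
theorem sq_mul_le_of_forall_lt {c X Y : ℝ} (hc : 0 < c)
    (h : ∀ k, 0 < k → k < c → k ^ 2 * X ≤ Y) : c ^ 2 * X ≤ Y := by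
  have ht : Filter.Tendsto (fun k : ℝ => k ^ 2 * X) (nhdsWithin c (Iio c))
      (nhds (c ^ 2 * X)) :=
    ((by fun_prop : Continuous fun k : ℝ => k ^ 2 * X).tendsto c).mono_left nhdsWithin_le_nhds
  refine le_of_tendsto ht ?_
  filter_upwards [Ioo_mem_nhdsLT hc] with k hk using h k hk.1 hk.2

/-- The Poincaré inequality for functions vanishing at the walls. For `k < π / 2`,
`‖v'‖² - k² ‖v‖²` is `‖v' + t v‖²` up to an exact derivative, where `t = k tan (k y)`. -/
theorem poincare_inequality {v v1 : ℝ → E} (h0 : DerivOn v v1) (hc : ContinuousOn v1 channel)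
    (hl : v (-1) = 0) (hr : v 1 = 0) :
    (Real.pi / 2) ^ 2 * ∫ y in (-1 : ℝ)..1, ‖v y‖ ^ 2 ≤ ∫ y in (-1 : ℝ)..1, ‖v1 y‖ ^ 2 := by
  refine sq_mul_le_of_forall_lt (by positivity) fun k hk0 hk => ?_
  have hcos : ∀ y ∈ channel, Real.cos (k * y) ≠ 0 := by
    intro y hy
    refine (Real.cos_pos_of_mem_Ioo ⟨?_, ?_⟩).ne'
    · nlinarith [hy.1]
    · nlinarith [hy.2]
  set t : ℝ → ℝ := fun y => k * Real.tan (k * y) with ht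
  have htd : DerivOn t fun y => k ^ 2 + t y ^ 2 := by
    intro y hy
    have h1 := (Real.hasDerivAt_tan (hcos y hy)).comp y ((hasDerivAt_id y).const_mul k)
    refine ((h1.const_mul k).congr_deriv ?_).hasDerivWithinAt
    simp only [ht, Real.tan_eq_sin_div_cos]
    field_simp [hcos y hy]
    linear_combination (-1) * Real.sin_sq_add_cos_sq (k * y)
  have hvc := h0.continuousOn
  have htc := htd.continuousOn
  have hH : DerivOn (fun y => t y * ⟪v y, v y⟫_ℝ) fun y =>
      (k ^ 2 + t y ^ 2) * ⟪v y, v y⟫_ℝ + t y * (⟪v y, v1 y⟫_ℝ + ⟪v1 y, v y⟫_ℝ) :=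
    fun y hy => (htd y hy).mul ((h0 y hy).inner ℝ (h0 y hy))
  have hz := hH.integral_eq_zero (by fun_prop) (by simp [hl]) (by simp [hr])
  have hpos := integral_norm_sq_nonneg fun y => v1 y + t y • v y
  have hexp : ∀ y, ‖v1 y + t y • v y‖ ^ 2 = ‖v1 y‖ ^ 2 - k ^ 2 * ‖v y‖ ^ 2 +
      ((k ^ 2 + t y ^ 2) * ⟪v y, v y⟫_ℝ + t y * (⟪v y, v1 y⟫_ℝ + ⟪v1 y, v y⟫_ℝ)) := by
    intro y
    rw [norm_add_sq_real, norm_smul, inner_smul_right, real_inner_self_eq_norm_sq,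
      real_inner_comm (v1 y) (v y), mul_pow, Real.norm_eq_abs, sq_abs]
    ring
  simp only [hexp] at hpos
  rw [intervalIntegral.integral_add (intervalIntegrable_channel (by fun_prop))
      (intervalIntegrable_channel (by fun_prop)), hz, add_zero,
    intervalIntegral.integral_sub (intervalIntegrable_channel (by fun_prop))
      (intervalIntegrable_channel (by fun_prop)), intervalIntegral.integral_const_mul] at hpos
  linarith

/-- Jacobi's factorization for second-order quadratic functionals: for clamped `v`,
`‖v''‖² + (a² - a' - 2b) ‖v'‖² + (b² - g') ‖v‖²` with `g = a b - b'` equals `‖v'' + a v' + b v‖²`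
up to an exact derivative, hence has nonnegative integral. -/
theorem jacobi_factorization {v v1 v2 : ℝ → E} (h0 : DerivOn v v1) (h1 : DerivOn v1 v2)
    (hc : ContinuousOn v2 channel) (hl : v (-1) = 0) (hr : v 1 = 0)
    (hl' : v1 (-1) = 0) (hr' : v1 1 = 0) {a a' b b' g' : ℝ → ℝ} {A B : ℝ}
    (ha : DerivOn a a') (hb : DerivOn b b') (hg : DerivOn (fun y => a y * b y - b' y) g')
    (hA : ∀ y ∈ channel, a y ^ 2 - a' y - 2 * b y = A)
    (hB : ∀ y ∈ channel, b y ^ 2 - g' y = B) :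
    0 ≤ (∫ y in (-1 : ℝ)..1, ‖v2 y‖ ^ 2) + A * (∫ y in (-1 : ℝ)..1, ‖v1 y‖ ^ 2)
      + B * ∫ y in (-1 : ℝ)..1, ‖v y‖ ^ 2 := by
  have hvc := h0.continuousOn
  have hv1c := h1.continuousOn
  have hac := ha.continuousOn
  have hbc := hb.continuousOn
  set H' : ℝ → ℝ := fun y =>
      (a' y * ⟪v1 y, v1 y⟫_ℝ + a y * (⟪v1 y, v2 y⟫_ℝ + ⟪v2 y, v1 y⟫_ℝ))
      + 2 * (b' y * ⟪v y, v1 y⟫_ℝ + b y * (⟪v y, v2 y⟫_ℝ + ⟪v1 y, v1 y⟫_ℝ))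
      + (g' y * ⟪v y, v y⟫_ℝ + (a y * b y - b' y) * (⟪v y, v1 y⟫_ℝ + ⟪v1 y, v y⟫_ℝ)) with hH'
  have hH : DerivOn (fun y => a y * ⟪v1 y, v1 y⟫_ℝ + 2 * (b y * ⟪v y, v1 y⟫_ℝ)
      + (a y * b y - b' y) * ⟪v y, v y⟫_ℝ) H' := by
    intro y hy
    have i11 := (h1 y hy).inner ℝ (h1 y hy)
    have i01 := (h0 y hy).inner ℝ (h1 y hy)
    have i00 := (h0 y hy).inner ℝ (h0 y hy)
    exact (((ha y hy).mul i11).add (((hb y hy).mul i01).const_mul 2)).add ((hg y hy).mul i00)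
  have hexp : ∀ y ∈ channel, ‖v2 y + a y • v1 y + b y • v y‖ ^ 2
      - (‖v2 y‖ ^ 2 + A * ‖v1 y‖ ^ 2 + B * ‖v y‖ ^ 2) = H' y := by
    intro y hy
    rw [← hA y hy, ← hB y hy, hH', norm_add_sq_real, norm_add_sq_real, inner_add_left]
    simp only [norm_smul, inner_smul_right, inner_smul_left, real_inner_self_eq_norm_sq, mul_pow,
      Real.norm_eq_abs, sq_abs, real_inner_comm (v y) (v1 y), real_inner_comm (v y) (v2 y),
      real_inner_comm (v1 y) (v2 y)]
    simp only [conj_trivial]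
    ring
  have hH'c : ContinuousOn H' channel :=
    ContinuousOn.congr (by fun_prop) fun y hy => (hexp y hy).symm
  have hz := hH.integral_eq_zero hH'c (by simp [hl, hl']) (by simp [hr, hr'])
  have hpos := integral_norm_sq_nonneg fun y => v2 y + a y • v1 y + b y • v y
  have heq : ∫ y in (-1 : ℝ)..1, H' y = ∫ y in (-1 : ℝ)..1,
      (‖v2 y + a y • v1 y + b y • v y‖ ^ 2
        - (‖v2 y‖ ^ 2 + A * ‖v1 y‖ ^ 2 + B * ‖v y‖ ^ 2)) :=
    intervalIntegral.integral_congr fun y hy =>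
      (hexp y (by rwa [uIcc_of_le (by norm_num)] at hy)).symm
  rw [hz, intervalIntegral.integral_sub (intervalIntegrable_channel (by fun_prop))
      (intervalIntegrable_channel (by fun_prop)),
    intervalIntegral.integral_add (intervalIntegrable_channel (by fun_prop))
      (intervalIntegrable_channel (by fun_prop)),
    intervalIntegral.integral_add (intervalIntegrable_channel (by fun_prop))
      (intervalIntegrable_channel (by fun_prop)), intervalIntegral.integral_const_mul,
    intervalIntegral.integral_const_mul] at heq
  linarith

end Poincare

section Sharp

variable {E : Type*} [NormedAddCommGroup E] [InnerProductSpace ℝ E]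

/-- Jacobi's factorization in terms of the Wronskian `W` of two solutions `φ₁, φ₂` of the
Euler–Lagrange equation `φ'''' - A φ'' + B φ = 0` and of `P = φ₁' φ₂'' - φ₁'' φ₂'`, up to a common
factor, in the scaled variable `s = k y + s₀`: take `a = -k W' / W` and `b = k² P / W`. -/
theorem jacobi_wronskian {v v1 v2 : ℝ → E} (h0 : DerivOn v v1) (h1 : DerivOn v1 v2)
    (hc : ContinuousOn v2 channel) (hl : v (-1) = 0) (hr : v 1 = 0)
    (hl' : v1 (-1) = 0) (hr' : v1 1 = 0) {W W1 W2 P P1 P2 : ℝ → ℝ} {A B : ℝ} (k s₀ : ℝ)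
    (hW : ∀ s, HasDerivAt W (W1 s) s) (hW1 : ∀ s, HasDerivAt W1 (W2 s) s)
    (hP : ∀ s, HasDerivAt P (P1 s) s) (hP1 : ∀ s, HasDerivAt P1 (P2 s) s)
    (hne : ∀ y ∈ channel, W (k * y + s₀) ≠ 0)
    (hA : ∀ s, W2 s - 2 * P s = A * W s)
    (hB : ∀ s, P s ^ 2 + P2 s * W s - P1 s * W1 s = B * W s ^ 2) :
    0 ≤ (∫ y in (-1 : ℝ)..1, ‖v2 y‖ ^ 2) + A * k ^ 2 * (∫ y in (-1 : ℝ)..1, ‖v1 y‖ ^ 2)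
      + B * k ^ 4 * ∫ y in (-1 : ℝ)..1, ‖v y‖ ^ 2 := by
  have hs : ∀ y, HasDerivAt (fun y => k * y + s₀) k y := fun y => by
    simpa using ((hasDerivAt_id y).const_mul k).add_const s₀
  have comp : ∀ {f f' : ℝ → ℝ}, (∀ s, HasDerivAt f (f' s) s) → ∀ y,
      HasDerivAt (fun y => f (k * y + s₀)) (f' (k * y + s₀) * k) y :=
    fun h y => (h (k * y + s₀)).comp y (hs y)
  have hg0 : DerivOn (fun y => -(k ^ 3 * (P1 (k * y + s₀) / W (k * y + s₀))))
      (fun y => -(k ^ 3 * ((P2 (k * y + s₀) * k * W (k * y + s₀)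
        - P1 (k * y + s₀) * (W1 (k * y + s₀) * k)) / W (k * y + s₀) ^ 2))) := fun y hy =>
    ((((comp hP1 y).div (comp hW y) (hne y hy)).const_mul (k ^ 3)).neg).hasDerivWithinAt
  refine jacobi_factorization h0 h1 hc hl hr hl' hr'
    (a := fun y => -(k * (W1 (k * y + s₀) / W (k * y + s₀))))
    (b := fun y => k ^ 2 * (P (k * y + s₀) / W (k * y + s₀)))
    (fun y hy => ((((comp hW1 y).div (comp hW y) (hne y hy)).const_mul k).neg).hasDerivWithinAt)
    (fun y hy => (((comp hP y).div (comp hW y) (hne y hy)).const_mul (k ^ 2)).hasDerivWithinAt)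
    (fun y hy => (hg0 y hy).congr_of_mem (fun z hz => ?_) hy) (fun y hy => ?_) (fun y hy => ?_)
  · have := hne z hz
    field_simp
    ring
  · have := hne y hy
    field_simp
    linear_combination (k ^ 2 * W (k * y + s₀)) * hA (k * y + s₀)
  · have := hne y hy
    field_simp
    linear_combination k ^ 4 * hB (k * y + s₀)

theorem mul_cos_lt_sin {x : ℝ} (h0 : 0 < x) (hpi : x < Real.pi) :
    x * Real.cos x < Real.sin x := by
  rcases lt_or_ge x (Real.pi / 2) with h | h
  · have hc : 0 < Real.cos x := Real.cos_pos_of_mem_Ioo ⟨by linarith, h⟩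
    have := Real.lt_tan h0 h
    rwa [Real.tan_eq_sin_div_cos, lt_div_iff₀ hc] at this
  · have hc : Real.cos x ≤ 0 := Real.cos_nonpos_of_pi_div_two_le_of_le h (by linarith)
    nlinarith [Real.sin_pos_of_pos_of_lt_pi h0 hpi]

/-- The Wronskian of `1 - cos s` and `s - sin s` is `4 sin x (sin x - x cos x)` with `x = s / 2`. -/
theorem buckling_wronskian_pos {s : ℝ} (h0 : 0 < s) (h : s < 2 * Real.pi) :
    0 < 2 - 2 * Real.cos s - s * Real.sin s := by
  have h1 := mul_cos_lt_sin (x := s / 2) (by linarith) (by linarith)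
  have h2 := Real.sin_pos_of_pos_of_lt_pi (x := s / 2) (by linarith) (by linarith)
  have e : s = 2 * (s / 2) := by ring
  rw [e, Real.cos_two_mul, Real.sin_two_mul]
  nlinarith [Real.sin_sq_add_cos_sq (s / 2), mul_pos h2 (sub_pos.2 h1)]

/-- The buckling inequality: `π²` is the least buckling load of the clamped rod `[-1, 1]`. -/
theorem buckling_inequality {v v1 v2 : ℝ → E} (h0 : DerivOn v v1) (h1 : DerivOn v1 v2)
    (hc : ContinuousOn v2 channel) (hl : v (-1) = 0) (hr : v 1 = 0)
    (hl' : v1 (-1) = 0) (hr' : v1 1 = 0) :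
    Real.pi ^ 2 * ∫ y in (-1 : ℝ)..1, ‖v1 y‖ ^ 2 ≤ ∫ y in (-1 : ℝ)..1, ‖v2 y‖ ^ 2 := by
  -- For `k < π`, the variable `s = k y + π` stays inside `(0, 2 π)`.
  refine sq_mul_le_of_forall_lt Real.pi_pos fun k hk0 hk => ?_
  have := jacobi_wronskian h0 h1 hc hl hr hl' hr' k Real.pi (A := -1) (B := 0)
    (W := fun s => 2 - 2 * Real.cos s - s * Real.sin s)
    (W1 := fun s => Real.sin s - s * Real.cos s) (W2 := fun s => s * Real.sin s)
    (P := fun s => 1 - Real.cos s) (P1 := Real.sin) (P2 := Real.cos)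
    (fun s => by
      refine ((((Real.hasDerivAt_cos s).const_mul 2).const_sub 2).sub
        ((hasDerivAt_id s).mul (Real.hasDerivAt_sin s))).congr_deriv ?_
      simp only [id]; ring)
    (fun s => by
      refine ((Real.hasDerivAt_sin s).sub
        ((hasDerivAt_id s).mul (Real.hasDerivAt_cos s))).congr_deriv ?_
      simp only [id]; ring)
    (fun s => by simpa using (Real.hasDerivAt_cos s).const_sub 1)
    Real.hasDerivAt_sin
    (fun y hy => (buckling_wronskian_pos (by nlinarith [hy.1]) (by nlinarith [hy.2])).ne')
    (fun s => by ring)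
    (fun s => by linear_combination (-1 : ℝ) * Real.sin_sq_add_cos_sq s)
  linarith

/-- The Wronskian of `cosh s - cos s` and `sinh s - sin s` is `2 (1 - cos s cosh s)`. The first
positive zero of `1 - cos s cosh s` is `4.730040…`, twice the exact clamped-rod
constant `2.365020…`. -/
theorem rod_wronskian_pos {s : ℝ} (h0 : 0 < s) (h : s ≤ 4.73001) :
    0 < 1 - Real.cos s * Real.cosh s := by
  have hC : 1 < Real.cosh s := Real.one_lt_cosh.2 h0.ne'
  rcases lt_or_ge s (Real.pi / 2) with h1 | h1
  · -- For `s < π / 2`, `cos s cosh s` decreases from `1`.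
    have hanti : StrictAntiOn (fun s => Real.cos s * Real.cosh s) (Icc 0 (Real.pi / 2)) := by
      refine strictAntiOn_of_deriv_neg (convex_Icc _ _) (by fun_prop) fun x hx => ?_
      rw [interior_Icc] at hx
      rw [show deriv (fun s => Real.cos s * Real.cosh s) x = _ from
        ((Real.hasDerivAt_cos x).mul (Real.hasDerivAt_cosh x)).deriv]
      have hc : 0 < Real.cos x := Real.cos_pos_of_mem_Ioo ⟨by linarith [hx.1], hx.2⟩
      have ht := Real.lt_tan hx.1 hx.2
      rw [Real.tan_eq_sin_div_cos, lt_div_iff₀ hc] at ht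
      have hS : Real.sinh x ≤ x * Real.cosh x := by
        have hmono : MonotoneOn (fun x => x * Real.cosh x - Real.sinh x) (Ici 0) := by
          refine monotoneOn_of_deriv_nonneg (convex_Ici _) (by fun_prop) (by fun_prop)
            fun z hz => ?_
          rw [interior_Ici] at hz
          rw [show deriv (fun x => x * Real.cosh x - Real.sinh x) z = _ from
            (((hasDerivAt_id z).mul (Real.hasDerivAt_cosh z)).sub
              (Real.hasDerivAt_sinh z)).deriv]
          simp only [id]
          nlinarith [mul_pos (mem_Ioi.1 hz) (Real.sinh_pos_iff.2 hz)]
        simpa using hmono (mem_Ici.2 le_rfl) (mem_Ici.2 hx.1.le) hx.1.le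
      nlinarith [Real.cosh_pos x]
    have := hanti ⟨le_rfl, by positivity⟩ ⟨h0.le, h1.le⟩ h0
    simp only [Real.cos_zero, Real.cosh_zero] at this
    linarith
  rcases le_or_gt s (Real.pi + Real.pi / 2) with h2 | h2
  · have := Real.cos_nonpos_of_pi_div_two_le_of_le h1 h2
    nlinarith
  · -- Beyond `3 π / 2`, `cos s = sin (s - 3 π / 2) ≤ s - 3 π / 2 < 0.0177`, `cosh s < 56.7`.
    have hpi := Real.pi_gt_d6
    have hcos : Real.cos s ≤ 0.017623 := by
      have e : Real.cos s = Real.sin (s - (Real.pi + Real.pi / 2)) := by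
        rw [← sub_sub, Real.sin_sub_pi_div_two, Real.cos_sub_pi, neg_neg]
      rw [e]
      refine (Real.sin_le (by linarith)).trans ?_
      linarith
    have hexp : Real.exp s < 113.32 := by
      -- The bound on `Real.exp` needs an argument in `[0, 1]`, hence the fifth root.
      have e1 : Real.exp s ≤ Real.exp (0.946002 : ℝ) ^ 5 := by
        rw [← Real.exp_nat_mul]
        exact Real.exp_le_exp.2 (by norm_num; linarith)
      have e2 : Real.exp (0.946002 : ℝ) < 2.5754 := by
        refine (Real.exp_bound' (n := 8) (by norm_num) (by norm_num) (by norm_num)).trans_lt ?_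
        norm_num [Finset.sum_range_succ, Nat.factorial]
      refine e1.trans_lt ((pow_lt_pow_left₀ e2 (Real.exp_pos _).le (by norm_num)).trans ?_)
      norm_num
    have hneg : Real.exp (-s) < 0.02 := by
      rw [Real.exp_neg, inv_lt_comm₀ (Real.exp_pos _) (by norm_num)]
      have e1 : Real.exp 1 ^ 4 ≤ Real.exp s := by
        rw [← Real.exp_nat_mul]
        exact Real.exp_le_exp.2 (by norm_num; linarith)
      refine lt_of_lt_of_le ?_ e1
      refine lt_trans ?_ (pow_lt_pow_left₀ Real.exp_one_gt_d9 (by norm_num) (by norm_num))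
      norm_num
    have hcosh : Real.cosh s < 56.7 := by
      rw [Real.cosh_eq]
      linarith
    nlinarith

/-- The vibrating-rod inequality: the lowest frequency of the clamped rod `[-1, 1]` is at least
`rodConst ^ 2`. -/
theorem rod_inequality {v v1 v2 : ℝ → E} (h0 : DerivOn v v1) (h1 : DerivOn v1 v2)
    (hc : ContinuousOn v2 channel) (hl : v (-1) = 0) (hr : v 1 = 0)
    (hl' : v1 (-1) = 0) (hr' : v1 1 = 0) :
    rodConst ^ 2 * ∫ y in (-1 : ℝ)..1, ‖v y‖ ^ 2 ≤ ∫ y in (-1 : ℝ)..1, ‖v2 y‖ ^ 2 := by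
  -- The shift `2.365005` makes `s` run over `[5e-6, 4.730005]`, away from the zero `s = 0`.
  have := jacobi_wronskian h0 h1 hc hl hr hl' hr' 2.365 2.365005 (A := 0) (B := -1)
    (W := fun s => 1 - Real.cos s * Real.cosh s)
    (W1 := fun s => Real.sin s * Real.cosh s - Real.cos s * Real.sinh s)
    (W2 := fun s => 2 * (Real.sin s * Real.sinh s))
    (P := fun s => Real.sin s * Real.sinh s)
    (P1 := fun s => Real.cos s * Real.sinh s + Real.sin s * Real.cosh s)
    (P2 := fun s => 2 * (Real.cos s * Real.cosh s))
    (fun s => (((Real.hasDerivAt_cos s).mul (Real.hasDerivAt_cosh s)).const_sub 1).congr_deriv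
      (by ring))
    (fun s => (((Real.hasDerivAt_sin s).mul (Real.hasDerivAt_cosh s)).sub
      ((Real.hasDerivAt_cos s).mul (Real.hasDerivAt_sinh s))).congr_deriv (by ring))
    (fun s => (Real.hasDerivAt_sin s).mul (Real.hasDerivAt_sinh s))
    (fun s => (((Real.hasDerivAt_cos s).mul (Real.hasDerivAt_sinh s)).add
      ((Real.hasDerivAt_sin s).mul (Real.hasDerivAt_cosh s))).congr_deriv (by ring))
    (fun y hy => (rod_wronskian_pos (by linarith [hy.1]) (by linarith [hy.2])).ne')
    (fun s => by ring)
    (fun s => by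
      have e1 := Real.sin_sq_add_cos_sq s
      have e2 := Real.cosh_sq s
      linear_combination (Real.sinh s ^ 2 - Real.cosh s ^ 2) * e1 - e2)
  rw [rodConst]
  linarith

end Sharp

/-! ### Unique continuation for linear fourth-order equations -/

theorem eqOn_channel_of_eqOn_Ioo {F : Type*} [TopologicalSpace F] [T2Space F] {f g : ℝ → F}
    (hf : ContinuousOn f channel) (hg : ContinuousOn g channel)
    (h : ∀ y ∈ Ioo (-1 : ℝ) 1, f y = g y) : ∀ y ∈ channel, f y = g y :=
  EqOn.of_subset_closure (s := Ioo (-1 : ℝ) 1) h hf hg Ioo_subset_channel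
    (by rw [closure_Ioo (by norm_num)]; rfl)

/-- Grönwall's uniqueness criterion on both sides of an interior zero. -/
theorem DerivOn.eq_zero_of_norm_le {F : Type*} [NormedAddCommGroup F] [NormedSpace ℝ F]
    {z z' : ℝ → F} (hz : DerivOn z z') {K : ℝ} (hK : ∀ y ∈ channel, ‖z' y‖ ≤ K * ‖z y‖)
    {y₀ : ℝ} (hy₀ : y₀ ∈ Ioo (-1 : ℝ) 1) (h0 : z y₀ = 0) : ∀ y ∈ channel, z y = 0 := by
  have hd : ∀ x ∈ Ioo (-1 : ℝ) 1, HasDerivAt z (z' x) x := fun x hx =>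
    (hz x (Ioo_subset_channel hx)).hasDerivAt (channel_mem_nhds hx)
  have hright : ∀ y ∈ Icc y₀ 1, z y = 0 := by
    refine eq_zero_of_abs_deriv_le_mul_abs_self_of_eq_zero_right
      (hz.continuousOn.mono (Icc_subset_Icc_left hy₀.1.le)) (f' := z') (K := K)
      (fun x hx => (hd x ⟨by linarith [hx.1, hy₀.1], hx.2⟩).hasDerivWithinAt) h0
      (fun x hx => hK x ⟨by linarith [hx.1, hy₀.1], hx.2.le⟩)
  have hleft : ∀ y ∈ Icc (-y₀) 1, z (-y) = 0 := by
    refine eq_zero_of_abs_deriv_le_mul_abs_self_of_eq_zero_right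
      (f := fun y => z (-y)) (f' := fun y => -z' (-y)) (K := K)
      (hz.continuousOn.comp continuous_neg.continuousOn fun y hy => ?_)
      (fun x hx => ?_) (by simpa using h0) (fun x hx => ?_)
    · exact ⟨by linarith [hy.2], by linarith [hy.1, hy₀.2]⟩
    · have := (hd (-x) ⟨by linarith [hx.2], by linarith [hx.1, hy₀.2]⟩).scomp x (hasDerivAt_neg x)
      simpa [Function.comp_def] using this.hasDerivWithinAt
    · rw [norm_neg]
      exact hK (-x) ⟨by linarith [hx.2], by linarith [hx.1, hy₀.2]⟩
  intro y hy
  rcases le_total y₀ y with h | h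
  · exact hright y ⟨h, hy.2⟩
  · simpa using hleft (-y) ⟨by linarith, by linarith [hy.1]⟩

theorem DerivOn.eq_zero_of_linear_ode {v v1 v2 v3 v4 d0 d1 d2 d3 : ℝ → ℂ}
    (h0 : DerivOn v v1) (h1 : DerivOn v1 v2) (h2 : DerivOn v2 v3) (h3 : DerivOn v3 v4)
    (c0 : ContinuousOn d0 channel) (c1 : ContinuousOn d1 channel)
    (c2 : ContinuousOn d2 channel) (c3 : ContinuousOn d3 channel)
    (hode : ∀ y ∈ channel, v4 y = d0 y * v y + d1 y * v1 y + d2 y * v2 y + d3 y * v3 y)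
    {y₀ : ℝ} (hy₀ : y₀ ∈ Ioo (-1 : ℝ) 1) (z0 : v y₀ = 0) (z1 : v1 y₀ = 0) (z2 : v2 y₀ = 0)
    (z3 : v3 y₀ = 0) : ∀ y ∈ channel, v y = 0 := by
  obtain ⟨K, hK⟩ := isCompact_channel.exists_bound_of_continuousOn
    (f := fun y => ‖d0 y‖ + ‖d1 y‖ + ‖d2 y‖ + ‖d3 y‖) (by fun_prop)
  have hz : DerivOn (fun y => (v y, v1 y, v2 y, v3 y)) (fun y => (v1 y, v2 y, v3 y, v4 y)) :=
    fun y hy => (h0 y hy).prodMk ((h1 y hy).prodMk ((h2 y hy).prodMk (h3 y hy)))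
  have key := hz.eq_zero_of_norm_le (K := max 1 K) (fun y hy => ?_) hy₀ (by simp [z0, z1, z2, z3])
  · exact fun y hy => congrArg Prod.fst (key y hy)
  set N := ‖(v y, v1 y, v2 y, v3 y)‖ with hN
  have n0 : ‖v y‖ ≤ N := norm_fst_le (v y, v1 y, v2 y, v3 y)
  have n123 : ‖(v1 y, v2 y, v3 y)‖ ≤ N := norm_snd_le (v y, v1 y, v2 y, v3 y)
  have n1 : ‖v1 y‖ ≤ N := (norm_fst_le (v1 y, v2 y, v3 y)).trans n123
  have n23 : ‖(v2 y, v3 y)‖ ≤ N := (norm_snd_le (v1 y, v2 y, v3 y)).trans n123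
  have n2 : ‖v2 y‖ ≤ N := (norm_fst_le (v2 y, v3 y)).trans n23
  have n3 : ‖v3 y‖ ≤ N := (norm_snd_le (v2 y, v3 y)).trans n23
  have hN0 : 0 ≤ N := norm_nonneg _
  have hone : N ≤ max 1 K * N := le_mul_of_one_le_left hN0 (le_max_left _ _)
  have n4 : ‖v4 y‖ ≤ max 1 K * N := by
    rw [hode y hy]
    calc _ ≤ ‖d0 y‖ * ‖v y‖ + ‖d1 y‖ * ‖v1 y‖ + ‖d2 y‖ * ‖v2 y‖ + ‖d3 y‖ * ‖v3 y‖ := by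
          simp only [← norm_mul]
          exact norm_add₄_le
      _ ≤ ‖d0 y‖ * N + ‖d1 y‖ * N + ‖d2 y‖ * N + ‖d3 y‖ * N := by gcongr
      _ = (‖d0 y‖ + ‖d1 y‖ + ‖d2 y‖ + ‖d3 y‖) * N := by ring
      _ ≤ max 1 K * N := by
          gcongr
          exact (Real.le_norm_self _).trans ((hK y hy).trans (le_max_right _ _))
  simp only [Prod.norm_def, max_le_iff]
  exact ⟨n1.trans hone, n2.trans hone, n3.trans hone, n4⟩

/-! ### Modes and their energy identities -/

/-- A clamped eigenmode `v` with eigenvalue `c`, together with all the derivatives entering the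
modified Orr–Sommerfeld equation; `t` is the tangent viscosity. The equation is in the form
`α [U (D² - α²) v - U'' v] + (i/Re) [(D² + α²) (t (D² + α²) v) - 4 α² (μ v')'] = c α (D² - α²) v`,
with the derivatives of products expanded. -/
structure ClampedMode (α Re : ℝ) (U U1 U2 μ μ1 t t1 t2 : ℝ → ℝ) (v v1 v2 v3 v4 : ℝ → ℂ)
    (c : ℂ) : Prop where
  hU : DerivOn U U1
  hU1 : DerivOn U1 U2
  hU2 : ContinuousOn U2 channel
  hμ : DerivOn μ μ1
  hμ1 : ContinuousOn μ1 channel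
  ht : DerivOn t t1
  ht1 : DerivOn t1 t2
  ht2 : ContinuousOn t2 channel
  hv : DerivOn v v1
  hv1 : DerivOn v1 v2
  hv2 : DerivOn v2 v3
  hv3 : DerivOn v3 v4
  hv4 : ContinuousOn v4 channel
  left : v (-1) = 0
  right : v 1 = 0
  left' : v1 (-1) = 0
  right' : v1 1 = 0
  ne_zero : ∃ y ∈ channel, v y ≠ 0
  eqn : ∀ y ∈ channel,
    (α : ℂ) * ((U y : ℂ) * (v2 y - (α : ℂ) ^ 2 * v y) - (U2 y : ℂ) * v y)
      + Complex.I / (Re : ℂ) *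
        (((t2 y : ℂ) * (v2 y + (α : ℂ) ^ 2 * v y)
            + 2 * (t1 y : ℂ) * (v3 y + (α : ℂ) ^ 2 * v1 y)
            + (t y : ℂ) * (v4 y + (α : ℂ) ^ 2 * v2 y))
          + (α : ℂ) ^ 2 * ((t y : ℂ) * (v2 y + (α : ℂ) ^ 2 * v y))
          - 4 * (α : ℂ) ^ 2 * ((μ1 y : ℂ) * v1 y + (μ y : ℂ) * v2 y))
      = c * (α : ℂ) * (v2 y - (α : ℂ) ^ 2 * v y)

theorem DerivOn.ofReal {f f' : ℝ → ℝ} (h : DerivOn f f') :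
    DerivOn (fun y => (f y : ℂ)) (fun y => (f' y : ℂ)) :=
  fun y hy => (h y hy).ofReal_comp

/-- The energy density `|v'|² + α² |v|²`. -/
noncomputable def energyDensity (α : ℝ) (v v1 : ℝ → ℂ) (y : ℝ) : ℝ :=
  ‖v1 y‖ ^ 2 + α ^ 2 * ‖v y‖ ^ 2

namespace ClampedMode

variable {α Re : ℝ} {U U1 U2 μ μ1 t t1 t2 : ℝ → ℝ} {v v1 v2 v3 v4 : ℝ → ℂ} {c : ℂ}

/-- Unique continuation: since `t > 0`, the equation can be solved for `v''''`. -/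
theorem eq_zero_of_jet_eq_zero (M : ClampedMode α Re U U1 U2 μ μ1 t t1 t2 v v1 v2 v3 v4 c)
    (hRe : 0 < Re) (htpos : ∀ y ∈ channel, 0 < t y)
    {y₀ : ℝ} (hy₀ : y₀ ∈ Ioo (-1 : ℝ) 1) (z0 : v y₀ = 0) (z1 : v1 y₀ = 0) (z2 : v2 y₀ = 0)
    (z3 : v3 y₀ = 0) : ∀ y ∈ channel, v y = 0 := by
  have cU := M.hU.ofReal.continuousOn
  have cU2 : ContinuousOn (fun y => (U2 y : ℂ)) channel :=
    Complex.continuous_ofReal.comp_continuousOn M.hU2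
  have cμ := M.hμ.ofReal.continuousOn
  have cμ1 : ContinuousOn (fun y => (μ1 y : ℂ)) channel :=
    Complex.continuous_ofReal.comp_continuousOn M.hμ1
  have ct := M.ht.ofReal.continuousOn
  have ct1 := M.ht1.ofReal.continuousOn
  have ct2 : ContinuousOn (fun y => (t2 y : ℂ)) channel :=
    Complex.continuous_ofReal.comp_continuousOn M.ht2
  have hne : ∀ y ∈ channel, (t y : ℂ) ≠ 0 := fun y hy =>
    Complex.ofReal_ne_zero.2 (htpos y hy).ne'
  have hRe' : (Re : ℂ) ≠ 0 := Complex.ofReal_ne_zero.2 hRe.ne'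
  refine DerivOn.eq_zero_of_linear_ode M.hv M.hv1 M.hv2 M.hv3
    (d0 := fun y => (-(α : ℂ) ^ 2 * t2 y - (α : ℂ) ^ 4 * t y
      - Complex.I * Re * α * (-(c - U y) * (α : ℂ) ^ 2 + U2 y)) / t y)
    (d1 := fun y => (-2 * (α : ℂ) ^ 2 * t1 y + 4 * (α : ℂ) ^ 2 * μ1 y) / t y)
    (d2 := fun y => (-t2 y - 2 * (α : ℂ) ^ 2 * t y + 4 * (α : ℂ) ^ 2 * μ y
      - Complex.I * Re * α * (c - U y)) / t y)
    (d3 := fun y => (-2 * t1 y) / t y)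
    (ContinuousOn.div (by fun_prop) ct hne) (ContinuousOn.div (by fun_prop) ct hne)
    (ContinuousOn.div (by fun_prop) ct hne) (ContinuousOn.div (by fun_prop) ct hne)
    (fun y hy => ?_) hy₀ z0 z1 z2 z3
  have h := M.eqn y hy
  have := hne y hy
  field_simp at h ⊢
  have hI := Complex.I_sq
  linear_combination (-Complex.I) * h +
    ((t2 y : ℂ) * (v2 y + (α : ℂ) ^ 2 * v y) + 2 * (t1 y : ℂ) * (v3 y + (α : ℂ) ^ 2 * v1 y)
      + (t y : ℂ) * (v4 y + (α : ℂ) ^ 2 * v2 y)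
      + (α : ℂ) ^ 2 * ((t y : ℂ) * (v2 y + (α : ℂ) ^ 2 * v y))
      - 4 * (α : ℂ) ^ 2 * ((μ1 y : ℂ) * v1 y + (μ y : ℂ) * v2 y)) * hI

/-- A nonnegative continuous weight which is somewhere positive on the channel gives a positive
weighted energy: otherwise the mode would vanish on an open set. -/
theorem integral_weight_pos (M : ClampedMode α Re U U1 U2 μ μ1 t t1 t2 v v1 v2 v3 v4 c)
    (hα : 0 < α) (hRe : 0 < Re) (htpos : ∀ y ∈ channel, 0 < t y) {f : ℝ → ℝ}
    (hf : ContinuousOn f channel) (hf0 : ∀ y ∈ channel, 0 ≤ f y) (hne : ∃ y ∈ channel, f y ≠ 0) :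
    0 < ∫ y in (-1 : ℝ)..1, f y * energyDensity α v v1 y := by
  have hvc := M.hv.continuousOn
  have hv1c := M.hv1.continuousOn
  have he0 : ∀ y, 0 ≤ energyDensity α v v1 y := fun y => by unfold energyDensity; positivity
  refine integral_channel_pos (by unfold energyDensity; fun_prop)
    (fun y hy => mul_nonneg (hf0 y hy) (he0 y)) ?_
  by_contra! hcon
  obtain ⟨y₀, hy₀, hfy⟩ : ∃ y ∈ Ioo (-1 : ℝ) 1, f y ≠ 0 := by
    by_contra! h
    obtain ⟨y, hy, hy'⟩ := hne
    exact hy' (eqOn_channel_of_eqOn_Ioo hf continuousOn_const h y hy)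
  have hat : ∀ {g g' : ℝ → ℂ}, DerivOn g g' → g =ᶠ[nhds y₀] 0 → g' =ᶠ[nhds y₀] 0 := by
    intro g g' hg h
    filter_upwards [h.eventuallyEq_nhds, isOpen_Ioo.mem_nhds hy₀] with y hy hy'
    have h1 := (hg y (Ioo_subset_channel hy')).hasDerivAt (channel_mem_nhds hy')
    exact h1.unique ((hasDerivAt_const y (0 : ℂ)).congr_of_eventuallyEq hy)
  have hnear : v =ᶠ[nhds y₀] 0 := by
    have hfc : ContinuousAt f y₀ := hf.continuousAt (channel_mem_nhds hy₀)
    filter_upwards [hfc.eventually_ne hfy, channel_mem_nhds hy₀] with y h1 h2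
    have h3 : energyDensity α v v1 y ≤ 0 :=
      nonpos_of_mul_nonpos_right (hcon y h2) (lt_of_le_of_ne (hf0 y h2) h1.symm)
    have h4 : ‖v y‖ ^ 2 ≤ 0 := by
      unfold energyDensity at h3
      have : α ^ 2 * ‖v y‖ ^ 2 ≤ 0 := by nlinarith [sq_nonneg ‖v1 y‖]
      exact nonpos_of_mul_nonpos_right this (by positivity)
    simpa using h4
  have hnear1 := hat M.hv hnear
  have hnear2 := hat M.hv1 hnear1
  have hnear3 := hat M.hv2 hnear2
  obtain ⟨y, hy, hy'⟩ := M.ne_zero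
  exact hy' (M.eq_zero_of_jet_eq_zero hRe htpos hy₀ hnear.self_of_nhds hnear1.self_of_nhds
    hnear2.self_of_nhds hnear3.self_of_nhds y hy)

/-- The dissipation density `t |v'' + α² v|² + 4 α² μ |v'|²`. -/
noncomputable def dissipation (α : ℝ) (μ t : ℝ → ℝ) (v v1 v2 : ℝ → ℂ) (y : ℝ) : ℝ :=
  t y * ‖v2 y + (α : ℂ) ^ 2 * v y‖ ^ 2 + 4 * α ^ 2 * μ y * ‖v1 y‖ ^ 2

open ComplexConjugate in
/-- The pointwise energy identity. By the equation multiplied by `conj v`, the energy densities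
below add up to the derivative of a function which vanishes at the walls because `v` is clamped. -/
theorem exists_primitive (M : ClampedMode α Re U U1 U2 μ μ1 t t1 t2 v v1 v2 v3 v4 c) :
    ∃ G : ℝ → ℂ, G (-1) = 0 ∧ G 1 = 0 ∧ DerivOn G fun y =>
      (α : ℂ) * ((U y * energyDensity α v v1 y : ℝ) - (U1 y : ℂ) * (v y * conj (v1 y)))
        - Complex.I * (dissipation α μ t v v1 v2 y / Re : ℝ)
        - c * (α * energyDensity α v v1 y : ℝ) := by
  set F : ℝ → ℂ := fun y => (t y : ℂ) * (v2 y + (α : ℂ) ^ 2 * v y) with hF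
  set F1 : ℝ → ℂ := fun y => (t1 y : ℂ) * (v2 y + (α : ℂ) ^ 2 * v y)
    + (t y : ℂ) * (v3 y + (α : ℂ) ^ 2 * v1 y) with hF1
  have dF : DerivOn F F1 := fun y hy =>
    (M.ht.ofReal y hy).mul ((M.hv2 y hy).add ((M.hv y hy).const_mul _))
  have dF1 : DerivOn F1 fun y => (t2 y : ℂ) * (v2 y + (α : ℂ) ^ 2 * v y)
      + 2 * (t1 y : ℂ) * (v3 y + (α : ℂ) ^ 2 * v1 y)
      + (t y : ℂ) * (v4 y + (α : ℂ) ^ 2 * v2 y) := fun y hy =>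
    (((M.ht1.ofReal y hy).mul ((M.hv2 y hy).add ((M.hv y hy).const_mul _))).add
      ((M.ht.ofReal y hy).mul ((M.hv3 y hy).add ((M.hv1 y hy).const_mul _)))).congr_deriv
      (by simp only [Pi.add_apply]; ring)
  have dw : DerivOn (fun y => conj (v y)) fun y => conj (v1 y) := fun y hy => (M.hv y hy).star
  have dw1 : DerivOn (fun y => conj (v1 y)) fun y => conj (v2 y) := fun y hy => (M.hv1 y hy).star
  refine ⟨fun y => (α : ℂ) * ((U y : ℂ) * v1 y * conj (v y) - (U1 y : ℂ) * v y * conj (v y))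
    + Complex.I / Re * (F1 y * conj (v y) - F y * conj (v1 y)
      - 4 * (α : ℂ) ^ 2 * ((μ y : ℂ) * v1 y * conj (v y)))
    - c * α * (v1 y * conj (v y)), by simp [M.left, M.left'], by simp [M.right, M.right'],
    fun y hy => ?_⟩
  have dU := M.hU.ofReal y hy
  have dU1 := M.hU1.ofReal y hy
  have dμ := M.hμ.ofReal y hy
  have d0 := M.hv y hy
  have d1 := M.hv1 y hy
  have w0 := dw y hy
  have w1 := dw1 y hy
  refine (((((dU.mul d1).mul w0).sub ((dU1.mul d0).mul w0)).const_mul (α : ℂ)).add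
    (((((dF1 y hy).mul w0).sub ((dF y hy).mul w1)).sub
      (((dμ.mul d1).mul w0).const_mul (4 * (α : ℂ) ^ 2))).const_mul (Complex.I / Re))
    |>.sub ((d1.mul w0).const_mul (c * α))).congr_deriv ?_
  have e0 : ((‖v y‖ ^ 2 : ℝ) : ℂ) = v y * conj (v y) := by
    rw [Complex.mul_conj']; norm_cast
  have e1 : ((‖v1 y‖ ^ 2 : ℝ) : ℂ) = v1 y * conj (v1 y) := by
    rw [Complex.mul_conj']; norm_cast
  have e2 : ((‖v2 y + (α : ℂ) ^ 2 * v y‖ ^ 2 : ℝ) : ℂ)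
      = (v2 y + (α : ℂ) ^ 2 * v y) * (conj (v2 y) + (α : ℂ) ^ 2 * conj (v y)) := by
    have : conj (v2 y) + (α : ℂ) ^ 2 * conj (v y) = conj (v2 y + (α : ℂ) ^ 2 * v y) := by simp
    rw [this, Complex.mul_conj']; norm_cast
  simp only [Pi.mul_apply, energyDensity, dissipation, Complex.ofReal_add, Complex.ofReal_mul,
    Complex.ofReal_div, e0, e1, e2, hF, hF1, Complex.ofReal_ofNat, Complex.ofReal_pow]
  linear_combination conj (v y) * M.eqn y hy

end ClampedMode

/-! ### Bounds on growth rate and wave speed -/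

/-- The two coercivity constants: `x₂² ≥ l x₀ · π x₁` in both, while `2 α² x₁² + α⁴ x₀²` is bounded
below either by the arithmetic–geometric mean inequality or by its first term alone. -/
theorem max_mul_le_of_coercive {α x0 x1 x2 l : ℝ} (hα : 0 < α) (h0 : 0 ≤ x0) (h1 : 0 ≤ x1)
    (hl : 0 ≤ l) (h01 : Real.pi / 2 * x0 ≤ x1) (h12 : Real.pi * x1 ≤ x2) (h02 : l * x0 ≤ x2) :
    max (l * Real.pi + (2 : ℝ) ^ (3 / 2 : ℝ) * α ^ 3) (l * Real.pi + Real.pi * α ^ 2) * (x0 * x1)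
      ≤ x2 ^ 2 + 2 * α ^ 2 * x1 ^ 2 + α ^ 4 * x0 ^ 2 := by
  have hpi := Real.pi_pos
  have hx2 : (l * x0) * (Real.pi * x1) ≤ x2 * x2 :=
    mul_le_mul h02 h12 (by positivity) ((by positivity : 0 ≤ l * x0).trans h02)
  rw [max_mul_of_nonneg _ _ (by positivity)]
  refine max_le ?_ ?_
  · set r : ℝ := (2 : ℝ) ^ (3 / 2 : ℝ) with hr
    have hr2 : r ^ 2 = 8 := by
      rw [hr, ← Real.rpow_natCast, ← Real.rpow_mul (by norm_num)]
      norm_num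
    have hsq : (r / 2 * α * x1 - α ^ 2 * x0) ^ 2
        = 2 * α ^ 2 * x1 ^ 2 - r * α ^ 3 * (x0 * x1) + α ^ 4 * x0 ^ 2 := by
      linear_combination (α ^ 2 * x1 ^ 2 / 4) * hr2
    have hsq0 := sq_nonneg (r / 2 * α * x1 - α ^ 2 * x0)
    linarith
  · have h := mul_le_mul_of_nonneg_left (mul_le_mul_of_nonneg_right h01 h1)
      (by positivity : 0 ≤ 2 * α ^ 2)
    have h' : 0 ≤ α ^ 4 * x0 ^ 2 := by positivity
    nlinarith

namespace ClampedMode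

variable {α Re : ℝ} {U U1 U2 μ μ1 t t1 t2 : ℝ → ℝ} {v v1 v2 v3 v4 : ℝ → ℂ} {c : ℂ}

theorem continuousOn_energyDensity
    (M : ClampedMode α Re U U1 U2 μ μ1 t t1 t2 v v1 v2 v3 v4 c) :
    ContinuousOn (energyDensity α v v1) channel := by
  have hvc := M.hv.continuousOn
  have hv1c := M.hv1.continuousOn
  unfold energyDensity
  fun_prop

theorem integral_energyDensity (M : ClampedMode α Re U U1 U2 μ μ1 t t1 t2 v v1 v2 v3 v4 c) :
    ∫ y in (-1 : ℝ)..1, energyDensity α v v1 y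
      = (∫ y in (-1 : ℝ)..1, ‖v1 y‖ ^ 2) + α ^ 2 * ∫ y in (-1 : ℝ)..1, ‖v y‖ ^ 2 := by
  have hvc := M.hv.continuousOn
  have hv1c := M.hv1.continuousOn
  unfold energyDensity
  rw [intervalIntegral.integral_add (intervalIntegrable_channel (by fun_prop))
    (intervalIntegrable_channel (by fun_prop)), intervalIntegral.integral_const_mul]

/-- Real part of the energy identity. The term `-∫ U' Re (v conj v')` has been integrated by parts
to `½ ∫ U'' |v|²`. -/
theorem re_energy_identity (M : ClampedMode α Re U U1 U2 μ μ1 t t1 t2 v v1 v2 v3 v4 c)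
    (hα : 0 < α) :
    c.re * ∫ y in (-1 : ℝ)..1, energyDensity α v v1 y
      = (∫ y in (-1 : ℝ)..1, U y * energyDensity α v v1 y)
        + 1 / 2 * ∫ y in (-1 : ℝ)..1, U2 y * ‖v y‖ ^ 2 := by
  obtain ⟨G, hl, hr, hG⟩ := M.exists_primitive
  have hUc := M.hU.continuousOn
  have hU2c := M.hU2
  have hvc := M.hv.continuousOn
  have hec := M.continuousOn_energyDensity
  have hS : DerivOn (fun y => (G y).re + α / 2 * (U1 y * ‖v y‖ ^ 2)) fun y =>
      α * (U y * energyDensity α v v1 y + 1 / 2 * (U2 y * ‖v y‖ ^ 2)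
        - c.re * energyDensity α v v1 y) := by
    intro y hy
    have h1 : HasDerivWithinAt (fun y => (G y).re) _ channel y :=
      Complex.reCLM.hasFDerivAt.comp_hasDerivWithinAt y (hG y hy)
    have h2 := ((M.hU1 y hy).mul (M.hv y hy).norm_sq).const_mul (α / 2)
    refine (h1.add h2).congr_deriv ?_
    simp [Complex.inner]
    ring
  have hz := hS.integral_eq_zero (by fun_prop) (by simp [hl, M.left]) (by simp [hr, M.right])
  rw [intervalIntegral.integral_const_mul,
    intervalIntegral.integral_sub (intervalIntegrable_channel (by fun_prop))
      (intervalIntegrable_channel (by fun_prop)),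
    intervalIntegral.integral_add (intervalIntegrable_channel (by fun_prop))
      (intervalIntegrable_channel (by fun_prop)), intervalIntegral.integral_const_mul,
    intervalIntegral.integral_const_mul] at hz
  have := (mul_eq_zero.1 hz).resolve_left hα.ne'
  linarith

/-- Imaginary part of the energy identity, with the production term bounded by `|U'| ≤ q`. -/
theorem growth_le (M : ClampedMode α Re U U1 U2 μ μ1 t t1 t2 v v1 v2 v3 v4 c)
    (hα : 0 < α) {q : ℝ} (hq : ∀ y ∈ channel, |U1 y| ≤ q) :
    c.im * (α * ∫ y in (-1 : ℝ)..1, energyDensity α v v1 y)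
      ≤ α * q * (∫ y in (-1 : ℝ)..1, ‖v y‖ * ‖v1 y‖)
        - 1 / Re * ∫ y in (-1 : ℝ)..1, dissipation α μ t v v1 v2 y := by
  obtain ⟨G, hl, hr, hG⟩ := M.exists_primitive
  have hU1c := M.hU1.continuousOn
  have hvc := M.hv.continuousOn
  have hv1c := M.hv1.continuousOn
  have hv2c := M.hv2.continuousOn
  have hμc := M.hμ.continuousOn
  have htc := M.ht.continuousOn
  have hec := M.continuousOn_energyDensity
  have hdc : ContinuousOn (dissipation α μ t v v1 v2) channel := by
    unfold dissipation
    fun_prop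
  set J : ℝ → ℝ := fun y => (v y).im * (v1 y).re - (v y).re * (v1 y).im with hJ
  have hJc : ContinuousOn J channel := by fun_prop
  have hS : DerivOn (fun y => (G y).im) fun y =>
      -(α * (U1 y * J y)) - 1 / Re * dissipation α μ t v v1 v2 y
        - c.im * α * energyDensity α v v1 y := by
    intro y hy
    have h1 : HasDerivWithinAt (fun y => (G y).im) _ channel y :=
      Complex.imCLM.hasFDerivAt.comp_hasDerivWithinAt y (hG y hy)
    refine h1.congr_deriv ?_
    simp [hJ]
    ring
  have hz := hS.integral_eq_zero (by fun_prop) (by simp [hl]) (by simp [hr])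
  rw [intervalIntegral.integral_sub (intervalIntegrable_channel (by fun_prop))
      (intervalIntegrable_channel (by fun_prop)),
    intervalIntegral.integral_sub (intervalIntegrable_channel (by fun_prop))
      (intervalIntegrable_channel (by fun_prop)), intervalIntegral.integral_neg,
    intervalIntegral.integral_const_mul, intervalIntegral.integral_const_mul,
    intervalIntegral.integral_const_mul] at hz
  have hprod : -(∫ y in (-1 : ℝ)..1, U1 y * J y)
      ≤ q * ∫ y in (-1 : ℝ)..1, ‖v y‖ * ‖v1 y‖ := by
    rw [← intervalIntegral.integral_neg, ← intervalIntegral.integral_const_mul]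
    refine integral_channel_mono (by fun_prop) (by fun_prop) fun y hy => ?_
    have hJle : |J y| ≤ ‖v y‖ * ‖v1 y‖ := by
      have e : J y = (v y * (starRingEnd ℂ) (v1 y)).im := by simp [hJ]; ring
      rw [e]
      refine (Complex.abs_im_le_norm _).trans ?_
      rw [norm_mul, Complex.norm_conj]
    calc -(U1 y * J y) ≤ |U1 y * J y| := neg_le_abs _
      _ = |U1 y| * |J y| := abs_mul _ _
      _ ≤ q * (‖v y‖ * ‖v1 y‖) :=
        mul_le_mul (hq y hy) hJle (abs_nonneg _) ((abs_nonneg _).trans (hq y hy))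
  nlinarith [mul_le_mul_of_nonneg_left hprod hα.le]

/-- The dissipation controls `‖(D² - α²) v‖²`, because `p ≤ t ≤ μ`. -/
theorem dissipation_ge (M : ClampedMode α Re U U1 U2 μ μ1 t t1 t2 v v1 v2 v3 v4 c)
    {p : ℝ} (hp : ∀ y ∈ channel, p ≤ t y) (htμ : ∀ y ∈ channel, t y ≤ μ y) :
    p * ((∫ y in (-1 : ℝ)..1, ‖v2 y‖ ^ 2) + 2 * α ^ 2 * (∫ y in (-1 : ℝ)..1, ‖v1 y‖ ^ 2)
      + α ^ 4 * ∫ y in (-1 : ℝ)..1, ‖v y‖ ^ 2)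
      ≤ ∫ y in (-1 : ℝ)..1, dissipation α μ t v v1 v2 y := by
  have hvc := M.hv.continuousOn
  have hv1c := M.hv1.continuousOn
  have hv2c := M.hv2.continuousOn
  have hμc := M.hμ.continuousOn
  have htc := M.ht.continuousOn
  have hH : DerivOn (fun y => inner ℝ (v y) (v1 y)) _ := fun y hy =>
    (M.hv y hy).inner ℝ (M.hv1 y hy)
  have hz := hH.integral_eq_zero (by fun_prop) (by simp [M.left]) (by simp [M.right])
  have hexp : ∀ y, ‖v2 y + (α : ℂ) ^ 2 * v y‖ ^ 2 + 4 * α ^ 2 * ‖v1 y‖ ^ 2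
      = ‖v2 y‖ ^ 2 + 2 * α ^ 2 * ‖v1 y‖ ^ 2 + α ^ 4 * ‖v y‖ ^ 2
        + 2 * α ^ 2 * (inner ℝ (v y) (v2 y) + inner ℝ (v1 y) (v1 y)) := by
    intro y
    have e : (α : ℂ) ^ 2 * v y = (α ^ 2 : ℝ) • v y := by simp
    rw [e, norm_add_sq_real, norm_smul, inner_smul_right, real_inner_self_eq_norm_sq,
      real_inner_comm (v y) (v2 y), mul_pow, Real.norm_eq_abs, sq_abs]
    ring
  have hint : ∫ y in (-1 : ℝ)..1, (‖v2 y + (α : ℂ) ^ 2 * v y‖ ^ 2 + 4 * α ^ 2 * ‖v1 y‖ ^ 2)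
      = (∫ y in (-1 : ℝ)..1, ‖v2 y‖ ^ 2) + 2 * α ^ 2 * (∫ y in (-1 : ℝ)..1, ‖v1 y‖ ^ 2)
        + α ^ 4 * ∫ y in (-1 : ℝ)..1, ‖v y‖ ^ 2 := by
    simp only [hexp]
    rw [intervalIntegral.integral_add (intervalIntegrable_channel (by fun_prop))
        (intervalIntegrable_channel (by fun_prop)), intervalIntegral.integral_const_mul, hz,
      intervalIntegral.integral_add (intervalIntegrable_channel (by fun_prop))
        (intervalIntegrable_channel (by fun_prop)),
      intervalIntegral.integral_add (intervalIntegrable_channel (by fun_prop))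
        (intervalIntegrable_channel (by fun_prop)), intervalIntegral.integral_const_mul,
      intervalIntegral.integral_const_mul]
    ring
  rw [← hint, ← intervalIntegral.integral_const_mul]
  refine integral_channel_mono (by fun_prop) (by unfold dissipation; fun_prop) fun y hy => ?_
  have h1 := mul_le_mul_of_nonneg_right (hp y hy)
    (by positivity : 0 ≤ ‖v2 y + (α : ℂ) ^ 2 * v y‖ ^ 2)
  have h2 := mul_le_mul_of_nonneg_right ((hp y hy).trans (htμ y hy))
    (by positivity : 0 ≤ 4 * α ^ 2 * ‖v1 y‖ ^ 2)
  unfold dissipation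
  linarith

theorem integral_energyDensity_pos
    (M : ClampedMode α Re U U1 U2 μ μ1 t t1 t2 v v1 v2 v3 v4 c)
    (hα : 0 < α) (hRe : 0 < Re) (htpos : ∀ y ∈ channel, 0 < t y) :
    0 < ∫ y in (-1 : ℝ)..1, energyDensity α v v1 y := by
  simpa using M.integral_weight_pos hα hRe htpos (f := fun _ => 1) continuousOn_const
    (fun _ _ => zero_le_one) ⟨0, by constructor <;> norm_num, one_ne_zero⟩

/-- The Poincaré inequality, in the form of a bound of `‖v‖²` by the energy. -/
theorem poincare_energy (M : ClampedMode α Re U U1 U2 μ μ1 t t1 t2 v v1 v2 v3 v4 c) :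
    (Real.pi ^ 2 + 4 * α ^ 2) * (∫ y in (-1 : ℝ)..1, ‖v y‖ ^ 2)
      ≤ 4 * ∫ y in (-1 : ℝ)..1, energyDensity α v v1 y := by
  have := poincare_inequality M.hv M.hv1.continuousOn M.left M.right
  rw [M.integral_energyDensity]
  linarith

theorem integral_mul_sq_le (M : ClampedMode α Re U U1 U2 μ μ1 t t1 t2 v v1 v2 v3 v4 c) :
    2 * α * (∫ y in (-1 : ℝ)..1, ‖v y‖ * ‖v1 y‖)
      ≤ ∫ y in (-1 : ℝ)..1, energyDensity α v v1 y := by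
  have hvc := M.hv.continuousOn
  have hv1c := M.hv1.continuousOn
  rw [← intervalIntegral.integral_const_mul]
  refine integral_channel_mono (by fun_prop) M.continuousOn_energyDensity fun y _ => ?_
  unfold energyDensity
  nlinarith [sq_nonneg (‖v1 y‖ - α * ‖v y‖)]


theorem im_le (M : ClampedMode α Re U U1 U2 μ μ1 t t1 t2 v v1 v2 v3 v4 c)
    (hα : 0 < α) (hRe : 0 < Re) {p q : ℝ} (hp0 : 0 < p) (hp : ∀ y ∈ channel, p ≤ t y)
    (htμ : ∀ y ∈ channel, t y ≤ μ y) (hq : ∀ y ∈ channel, |U1 y| ≤ q) :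
    c.im ≤ q / (2 * α) - p / (α * Re) *
      (Real.pi ^ 2 * (Real.pi ^ 2 + α ^ 2) / (Real.pi ^ 2 + 4 * α ^ 2) + α ^ 2) := by
  have hI := M.integral_energyDensity_pos hα hRe fun y hy => hp0.trans_le (hp y hy)
  have hgrow := M.growth_le hα hq
  have hdiss := M.dissipation_ge hp htμ
  have hK := M.integral_mul_sq_le
  have hP := poincare_inequality M.hv M.hv1.continuousOn M.left M.right
  have hB := buckling_inequality M.hv M.hv1 M.hv2.continuousOn M.left M.right M.left' M.right'
  have hIe := M.integral_energyDensity
  have hq0 : 0 ≤ q := (abs_nonneg _).trans (hq _ left_mem_channel)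
  set I := ∫ y in (-1 : ℝ)..1, energyDensity α v v1 y
  set K := ∫ y in (-1 : ℝ)..1, ‖v y‖ * ‖v1 y‖
  set Q := ∫ y in (-1 : ℝ)..1, dissipation α μ t v v1 v2 y
  set X0 := ∫ y in (-1 : ℝ)..1, ‖v y‖ ^ 2
  set X1 := ∫ y in (-1 : ℝ)..1, ‖v1 y‖ ^ 2
  set X2 := ∫ y in (-1 : ℝ)..1, ‖v2 y‖ ^ 2
  set κ := Real.pi ^ 2 * (Real.pi ^ 2 + α ^ 2) / (Real.pi ^ 2 + 4 * α ^ 2) with hκ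
  have hpi := Real.pi_pos
  have hX : κ * I ≤ X2 + α ^ 2 * X1 := by
    have h1 : Real.pi ^ 2 * I ≤ (Real.pi ^ 2 + 4 * α ^ 2) * X1 := by
      rw [hIe]
      nlinarith [mul_le_mul_of_nonneg_left hP (by positivity : 0 ≤ 4 * α ^ 2)]
    calc κ * I = (Real.pi ^ 2 + α ^ 2) / (Real.pi ^ 2 + 4 * α ^ 2) * (Real.pi ^ 2 * I) := by
          rw [hκ]; ring
      _ ≤ (Real.pi ^ 2 + α ^ 2) / (Real.pi ^ 2 + 4 * α ^ 2)
          * ((Real.pi ^ 2 + 4 * α ^ 2) * X1) := by gcongr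
      _ = (Real.pi ^ 2 + α ^ 2) * X1 := by field_simp
      _ ≤ X2 + α ^ 2 * X1 := by linarith
  have hQ : p * ((κ + α ^ 2) * I) ≤ Q := by
    refine le_trans (mul_le_mul_of_nonneg_left ?_ hp0.le) hdiss
    nlinarith
  have h2 : 1 / Re * (p * ((κ + α ^ 2) * I)) ≤ 1 / Re * Q := by gcongr
  have h3 : α * q * K ≤ q / 2 * I := by nlinarith
  have h4 : c.im * (α * I) ≤ (q / (2 * α) - p / (α * Re) * (κ + α ^ 2)) * (α * I) := by
    have e : (q / (2 * α) - p / (α * Re) * (κ + α ^ 2)) * (α * I)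
        = q / 2 * I - 1 / Re * (p * ((κ + α ^ 2) * I)) := by
      field_simp
    rw [e]
    linarith
  exact le_of_mul_le_mul_right h4 (by positivity)

theorem cauchy_schwarz (M : ClampedMode α Re U U1 U2 μ μ1 t t1 t2 v v1 v2 v3 v4 c) :
    ∫ y in (-1 : ℝ)..1, ‖v y‖ * ‖v1 y‖
      ≤ √(∫ y in (-1 : ℝ)..1, ‖v y‖ ^ 2) * √(∫ y in (-1 : ℝ)..1, ‖v1 y‖ ^ 2) := by
  have hvc := M.hv.continuousOn
  have hv1c := M.hv1.continuousOn
  have hquad : ∀ s : ℝ, 0 ≤ (∫ y in (-1 : ℝ)..1, ‖v y‖ ^ 2) * (s * s)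
      + -2 * (∫ y in (-1 : ℝ)..1, ‖v y‖ * ‖v1 y‖) * s + ∫ y in (-1 : ℝ)..1, ‖v1 y‖ ^ 2 := by
    intro s
    have h : 0 ≤ ∫ y in (-1 : ℝ)..1, (‖v1 y‖ - s * ‖v y‖) ^ 2 :=
      intervalIntegral.integral_nonneg (by norm_num) fun _ _ => by positivity
    have e : ∀ y, (‖v1 y‖ - s * ‖v y‖) ^ 2
        = ‖v1 y‖ ^ 2 - 2 * s * (‖v y‖ * ‖v1 y‖) + s ^ 2 * ‖v y‖ ^ 2 := fun y => by ring
    simp only [e] at h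
    rw [intervalIntegral.integral_add (intervalIntegrable_channel (by fun_prop))
        (intervalIntegrable_channel (by fun_prop)),
      intervalIntegral.integral_sub (intervalIntegrable_channel (by fun_prop))
        (intervalIntegrable_channel (by fun_prop)), intervalIntegral.integral_const_mul,
      intervalIntegral.integral_const_mul] at h
    linarith
  have hdisc := discrim_le_zero hquad
  rw [← Real.sqrt_mul (integral_norm_sq_nonneg v)]
  refine Real.le_sqrt_of_sq_le ?_
  unfold discrim at hdisc
  linarith

/-- If the dissipation dominates the production then the mode does not grow. -/
theorem im_nonpos (M : ClampedMode α Re U U1 U2 μ μ1 t t1 t2 v v1 v2 v3 v4 c)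
    (hα : 0 < α) (hRe : 0 < Re) {p q : ℝ} (hp0 : 0 < p) (hp : ∀ y ∈ channel, p ≤ t y)
    (htμ : ∀ y ∈ channel, t y ≤ μ y) (hq : ∀ y ∈ channel, |U1 y| ≤ q)
    (hstab : q * α * Re < p * max (rodConst * Real.pi + (2 : ℝ) ^ (3 / 2 : ℝ) * α ^ 3)
        (rodConst * Real.pi + Real.pi * α ^ 2)) : c.im ≤ 0 := by
  have hI := M.integral_energyDensity_pos hα hRe fun y hy => hp0.trans_le (hp y hy)
  have hgrow := M.growth_le hα hq
  have hdiss := M.dissipation_ge hp htμ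
  have hP := poincare_inequality M.hv M.hv1.continuousOn M.left M.right
  have hB := buckling_inequality M.hv M.hv1 M.hv2.continuousOn M.left M.right M.left' M.right'
  have hR := rod_inequality M.hv M.hv1 M.hv2.continuousOn M.left M.right M.left' M.right'
  have hCS := M.cauchy_schwarz
  have hX0 := integral_norm_sq_nonneg v
  have hX1 := integral_norm_sq_nonneg v1
  have hX2 := integral_norm_sq_nonneg v2
  have hq0 : 0 ≤ q := (abs_nonneg _).trans (hq _ left_mem_channel)
  have hrod : 0 < rodConst := by unfold rodConst; norm_num
  set I := ∫ y in (-1 : ℝ)..1, energyDensity α v v1 y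
  set K := ∫ y in (-1 : ℝ)..1, ‖v y‖ * ‖v1 y‖
  set Q := ∫ y in (-1 : ℝ)..1, dissipation α μ t v v1 v2 y
  set X0 := ∫ y in (-1 : ℝ)..1, ‖v y‖ ^ 2
  set X1 := ∫ y in (-1 : ℝ)..1, ‖v1 y‖ ^ 2
  set X2 := ∫ y in (-1 : ℝ)..1, ‖v2 y‖ ^ 2
  have hs0 := Real.sq_sqrt hX0
  have hs1 := Real.sq_sqrt hX1
  have hs2 := Real.sq_sqrt hX2
  have hcoer := max_mul_le_of_coercive (x2 := √X2) hα (Real.sqrt_nonneg X0)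
    (Real.sqrt_nonneg X1) hrod.le
    (abs_le_of_sq_le_sq' (by rw [mul_pow, hs0, hs1]; exact hP) (Real.sqrt_nonneg _)).2
    (abs_le_of_sq_le_sq' (by rw [mul_pow, hs1, hs2]; exact hB) (Real.sqrt_nonneg _)).2
    (abs_le_of_sq_le_sq' (by rw [mul_pow, hs0, hs2]; exact hR) (Real.sqrt_nonneg _)).2
  rw [hs0, hs1, hs2] at hcoer
  have h1 : q * α * Re * K ≤ Q := by
    calc q * α * Re * K ≤ q * α * Re * (√X0 * √X1) := by gcongr
      _ ≤ p * max (rodConst * Real.pi + (2 : ℝ) ^ (3 / 2 : ℝ) * α ^ 3)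
          (rodConst * Real.pi + Real.pi * α ^ 2) * (√X0 * √X1) := by gcongr
      _ ≤ p * (X2 + 2 * α ^ 2 * X1 + α ^ 4 * X0) := by
          rw [mul_assoc]
          gcongr
      _ ≤ Q := hdiss
  have h2 : α * q * K ≤ 1 / Re * Q := by
    rw [one_div, ← div_eq_inv_mul, le_div_iff₀ hRe]
    linarith
  have h3 : c.im * (α * I) ≤ 0 := by linarith
  exact nonpos_of_mul_nonpos_left h3 (by positivity)

/-- Upper bound for the wave speed. It is strict because the energy cannot concentrate on the set
where `U` attains its maximum. -/
theorem re_lt (M : ClampedMode α Re U U1 U2 μ μ1 t t1 t2 v v1 v2 v3 v4 c)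
    (hα : 0 < α) (hRe : 0 < Re) (htpos : ∀ y ∈ channel, 0 < t y) {b d : ℝ}
    (hb : ∀ y ∈ channel, U y ≤ b) (hne : ∃ y ∈ channel, U y ≠ b)
    (hd : ∀ y ∈ channel, U2 y ≤ d) :
    c.re * (∫ y in (-1 : ℝ)..1, energyDensity α v v1 y)
      < b * (∫ y in (-1 : ℝ)..1, energyDensity α v v1 y)
        + d / 2 * ∫ y in (-1 : ℝ)..1, ‖v y‖ ^ 2 := by
  have hUc := M.hU.continuousOn
  have hU2c := M.hU2
  have hvc := M.hv.continuousOn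
  have hec := M.continuousOn_energyDensity
  have hpos := M.integral_weight_pos hα hRe htpos (f := fun y => b - U y) (by fun_prop)
    (fun y hy => sub_nonneg.2 (hb y hy)) (hne.imp fun y h => ⟨h.1, sub_ne_zero.2 h.2.symm⟩)
  simp only [sub_mul] at hpos
  rw [intervalIntegral.integral_sub (intervalIntegrable_channel (by fun_prop))
    (intervalIntegrable_channel (by fun_prop)), intervalIntegral.integral_const_mul] at hpos
  have hcurv : ∫ y in (-1 : ℝ)..1, U2 y * ‖v y‖ ^ 2
      ≤ ∫ y in (-1 : ℝ)..1, d * ‖v y‖ ^ 2 :=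
    integral_channel_mono (by fun_prop) (by fun_prop) fun y hy => by gcongr; exact hd y hy
  rw [intervalIntegral.integral_const_mul] at hcurv
  rw [M.re_energy_identity hα]
  linarith

/-- Lower bound for the wave speed, strict for the same reason as `re_lt`. -/
theorem lt_re (M : ClampedMode α Re U U1 U2 μ μ1 t t1 t2 v v1 v2 v3 v4 c)
    (hα : 0 < α) (hRe : 0 < Re) (htpos : ∀ y ∈ channel, 0 < t y) {b d : ℝ}
    (hb : ∀ y ∈ channel, b ≤ U y) (hne : ∃ y ∈ channel, U y ≠ b)
    (hd : ∀ y ∈ channel, d ≤ U2 y) :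
    b * (∫ y in (-1 : ℝ)..1, energyDensity α v v1 y) + d / 2 * (∫ y in (-1 : ℝ)..1, ‖v y‖ ^ 2)
      < c.re * ∫ y in (-1 : ℝ)..1, energyDensity α v v1 y := by
  have hUc := M.hU.continuousOn
  have hU2c := M.hU2
  have hvc := M.hv.continuousOn
  have hec := M.continuousOn_energyDensity
  have hpos := M.integral_weight_pos hα hRe htpos (f := fun y => U y - b) (by fun_prop)
    (fun y hy => sub_nonneg.2 (hb y hy)) (hne.imp fun y h => ⟨h.1, sub_ne_zero.2 h.2⟩)
  simp only [sub_mul] at hpos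
  rw [intervalIntegral.integral_sub (intervalIntegrable_channel (by fun_prop))
    (intervalIntegrable_channel (by fun_prop)), intervalIntegral.integral_const_mul] at hpos
  have hcurv : ∫ y in (-1 : ℝ)..1, d * ‖v y‖ ^ 2
      ≤ ∫ y in (-1 : ℝ)..1, U2 y * ‖v y‖ ^ 2 :=
    integral_channel_mono (by fun_prop) (by fun_prop) fun y hy => by gcongr; exact hd y hy
  rw [intervalIntegral.integral_const_mul] at hcurv
  rw [M.re_energy_identity hα]
  linarith

end ClampedMode

/-! ### The eigenvalue problem -/

/-- Shear thinning: `m' ≤ 0` at positive shear rates. At shear rate zero the product `m'(γ) γ` is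
zero whatever the value of `deriv m 0`. -/
theorem tanViscosity_le_effViscosity {m : ℝ → ℝ} (hm_anti : AntitoneOn m (Ici 0)) (U : ℝ → ℝ)
    (y : ℝ) : tanViscosity m U y ≤ effViscosity m U y := by
  unfold tanViscosity effViscosity
  rcases (abs_nonneg (D U y)).eq_or_lt' with h | h
  · simp [h]
  · have : deriv m |D U y| ≤ 0 := by
      rw [← derivWithin_of_mem_nhds (Ici_mem_nhds h)]
      exact hm_anti.derivWithin_nonpos
    nlinarith

theorem IsEigenvalue.exists_clampedMode {α Re : ℝ} (hα : 0 < α) {U μ μt : ℝ → ℝ}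
    (hU : ContDiffOn ℝ 2 U channel) (hμ : ContDiffOn ℝ 2 μ channel)
    (hμt : ContDiffOn ℝ 2 μt channel) {c : ℂ} (hc : IsEigenvalue α Re U μ μt c) :
    ∃ v : ℝ → ℂ, ClampedMode α Re U (D U) (D^[2] U) μ (D μ) μt (D μt) (D^[2] μt)
      v (D v) (D^[2] v) (D^[3] v) (D^[4] v) c := by
  obtain ⟨v, hv, hne, hl, hr, hl', hr', heq⟩ := hc
  have dU : DerivOn U (D U) := derivOn_iterate_D (k := 0) (n := 2) hU (by norm_num)
  have dU1 : DerivOn (D U) (D^[2] U) := derivOn_iterate_D (k := 1) (n := 2) hU (by norm_num)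
  have cU2 : ContinuousOn (D^[2] U) channel := continuousOn_iterate_D (n := 2) hU le_rfl
  have dμ : DerivOn μ (D μ) := derivOn_iterate_D (k := 0) (n := 2) hμ (by norm_num)
  have dμ1 : DerivOn (D μ) (D^[2] μ) := derivOn_iterate_D (k := 1) (n := 2) hμ (by norm_num)
  have dt : DerivOn μt (D μt) := derivOn_iterate_D (k := 0) (n := 2) hμt (by norm_num)
  have dt1 : DerivOn (D μt) (D^[2] μt) := derivOn_iterate_D (k := 1) (n := 2) hμt (by norm_num)
  have ct2 : ContinuousOn (D^[2] μt) channel := continuousOn_iterate_D (n := 2) hμt le_rfl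
  have d0 : DerivOn v (D v) := derivOn_iterate_D (k := 0) (n := 4) hv (by norm_num)
  have d1 : DerivOn (D v) (D^[2] v) := derivOn_iterate_D (k := 1) (n := 4) hv (by norm_num)
  have d2 : DerivOn (D^[2] v) (D^[3] v) := derivOn_iterate_D (k := 2) (n := 4) hv (by norm_num)
  have d3 : DerivOn (D^[3] v) (D^[4] v) := derivOn_iterate_D (k := 3) (n := 4) hv (by norm_num)
  have c4 : ContinuousOn (D^[4] v) channel := continuousOn_iterate_D (n := 4) hv le_rfl
  refine ⟨v, dU, dU1, cU2, dμ, dμ1.continuousOn, dt, dt1, ct2, d0, d1, d2, d3, c4, hl, hr, hl',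
    hr', hne, ?_⟩
  have dg : DerivOn (fun y => μt y - μ y) (fun y => D μt y - D μ y) :=
    fun y hy => (dt y hy).sub (dμ y hy)
  have dg1 : DerivOn (fun y => D μt y - D μ y) (fun y => D^[2] μt y - D^[2] μ y) :=
    fun y hy => (dt1 y hy).sub (dμ1 y hy)
  have dh : DerivOn (fun y => D^[2] v y + (α : ℂ) ^ 2 * v y)
      (fun y => D^[3] v y + (α : ℂ) ^ 2 * D v y) :=
    fun y hy => (d2 y hy).add ((d0 y hy).const_mul _)
  have dh1 : DerivOn (fun y => D^[3] v y + (α : ℂ) ^ 2 * D v y)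
      (fun y => D^[4] v y + (α : ℂ) ^ 2 * D^[2] v y) :=
    fun y hy => (d3 y hy).add ((d1 y hy).const_mul _)
  have ds : DerivOn (stressFactor α μ μt v) _ := fun y hy =>
    (dg.ofReal y hy).mul (dh y hy)
  have ds1 := fun y hy => ((dg1.ofReal y hy).mul (dh y hy)).add ((dg.ofReal y hy).mul (dh1 y hy))
  have hs : ∀ y ∈ channel, D^[2] (stressFactor α μ μt v) y = _ :=
    fun y hy => ds.iterate_D_two_eq ds1 hy
  have cU := dU.ofReal.continuousOn
  have cU2' : ContinuousOn (fun y => ((D^[2] U y : ℝ) : ℂ)) channel :=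
    Complex.continuous_ofReal.comp_continuousOn cU2
  have cμ := dμ.ofReal.continuousOn
  have cμ1 := dμ1.ofReal.continuousOn
  have ct := dt.ofReal.continuousOn
  have ct1 := dt1.ofReal.continuousOn
  have ct2' : ContinuousOn (fun y => ((D^[2] μt y : ℝ) : ℂ)) channel :=
    Complex.continuous_ofReal.comp_continuousOn ct2
  have c0 := d0.continuousOn
  have c1 := d1.continuousOn
  have c2 := d2.continuousOn
  have c3 := d3.continuousOn
  refine eqOn_channel_of_eqOn_Ioo (by fun_prop) (by fun_prop) fun y hy => ?_
  have h := heq y hy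
  rw [orrSommerfeldOp, hs y (Ioo_subset_channel hy), stressFactor] at h
  have hα' : (α : ℂ) ≠ 0 := Complex.ofReal_ne_zero.2 hα.ne'
  rw [one_div, inv_mul_eq_iff_eq_mul₀ hα'] at h
  simp only [Complex.ofReal_sub] at h
  linear_combination h

end OrrSommerfeld

theorem mainTheorem2 (α Re : ℝ) (hα : 0 < α) (hRe : 0 < Re)
    (U : ℝ → ℝ) (hU : ContDiffOn ℝ 2 U channel)
    (m : ℝ → ℝ) (hm_anti : AntitoneOn m (Ici 0)) (hm_diff : DifferentiableOn ℝ m (Ioi 0))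
    (μ μt : ℝ → ℝ) (hμ_def : μ = effViscosity m U) (hμt_def : μt = tanViscosity m U)
    (hμ : ContDiffOn ℝ 2 μ channel) (hμt : ContDiffOn ℝ 2 μt channel)
    (hμt_pos : ∀ y ∈ channel, 0 < μt y)
    (q p Umin Umax U2min U2max : ℝ)
    (hq : q = maxCh (fun y => |D U y|)) (hp : p = minCh μt)
    (hUmin : Umin = minCh U) (hUmax : Umax = maxCh U)
    (hU2min : U2min = minCh (D^[2] U)) (hU2max : U2max = maxCh (D^[2] U)) :
    (∀ c : ℂ, IsEigenvalue α Re U μ μt c →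
      c.im ≤ q / (2 * α) - p / (α * Re) *
        (Real.pi ^ 2 * (Real.pi ^ 2 + α ^ 2) / (Real.pi ^ 2 + 4 * α ^ 2) + α ^ 2)) ∧
    (q * α * Re < p * max (rodConst * Real.pi + (2 : ℝ) ^ (3 / 2 : ℝ) * α ^ 3)
        (rodConst * Real.pi + Real.pi * α ^ 2) →
      ¬ ∃ c : ℂ, IsEigenvalue α Re U μ μt c ∧ 0 < c.im) ∧
    ((∃ y ∈ channel, ∃ z ∈ channel, U y ≠ U z) →
      ∀ c : ℂ, IsEigenvalue α Re U μ μt c →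
        (0 ≤ U2min →
          Umin < c.re ∧ c.re < Umax + 2 * U2max / (Real.pi ^ 2 + 4 * α ^ 2)) ∧
        (U2min ≤ 0 → 0 ≤ U2max →
          Umin + 2 * U2min / (Real.pi ^ 2 + 4 * α ^ 2) < c.re ∧
            c.re < Umax + 2 * U2max / (Real.pi ^ 2 + 4 * α ^ 2)) ∧
        (U2max ≤ 0 →
          Umin + 2 * U2min / (Real.pi ^ 2 + 4 * α ^ 2) < c.re ∧ c.re < Umax)) := by
  have cU : ContinuousOn U channel := hU.continuousOn
  have cU1 : ContinuousOn (fun y => |D U y|) channel :=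
    (continuousOn_iterate_D (k := 1) (n := 2) hU (by norm_num)).abs
  have cU2 : ContinuousOn (D^[2] U) channel := continuousOn_iterate_D (n := 2) hU le_rfl
  have hp0 : 0 < p := hp ▸ minCh_pos hμt.continuousOn hμt_pos
  have hple : ∀ y ∈ channel, p ≤ μt y := fun y hy => hp ▸ minCh_le hμt.continuousOn hy
  have hqle : ∀ y ∈ channel, |D U y| ≤ q := fun y hy => hq ▸ le_maxCh cU1 hy
  have htμ : ∀ y ∈ channel, μt y ≤ μ y := fun y _ => by
    rw [hμ_def, hμt_def]
    exact tanViscosity_le_effViscosity hm_anti U y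
  refine ⟨fun c hc => ?_, fun hstab => ?_, fun hnc c hc => ?_⟩
  · obtain ⟨v, M⟩ := hc.exists_clampedMode hα hU hμ hμt
    exact M.im_le hα hRe hp0 hple htμ hqle
  · rintro ⟨c, hc, hpos⟩
    obtain ⟨v, M⟩ := hc.exists_clampedMode hα hU hμ hμt
    exact absurd (M.im_nonpos hα hRe hp0 hple htμ hqle hstab) hpos.not_ge
  · obtain ⟨v, M⟩ := hc.exists_clampedMode hα hU hμ hμt
    have hne : ∀ b, ∃ y ∈ channel, U y ≠ b := by
      intro b
      by_contra! h
      obtain ⟨y, hy, z, hz, hyz⟩ := hnc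
      exact hyz ((h y hy).trans (h z hz).symm)
    have hI := M.integral_energyDensity_pos hα hRe hμt_pos
    have hlt := M.re_lt hα hRe hμt_pos (fun y hy => hUmax ▸ le_maxCh cU hy) (hne Umax)
      (fun y hy => hU2max ▸ le_maxCh cU2 hy)
    have hgt := M.lt_re hα hRe hμt_pos (fun y hy => hUmin ▸ minCh_le cU hy) (hne Umin)
      (fun y hy => hU2min ▸ minCh_le cU2 hy)
    have hPE := M.poincare_energy
    have hX := integral_norm_sq_nonneg v
    set I := ∫ y in (-1 : ℝ)..1, energyDensity α v (D v) y
    set X := ∫ y in (-1 : ℝ)..1, ‖v y‖ ^ 2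
    have hκ : 0 < Real.pi ^ 2 + 4 * α ^ 2 := by positivity
    set κ := Real.pi ^ 2 + 4 * α ^ 2
    have hXI : X ≤ 4 * I / κ := by rw [le_div_iff₀ hκ]; linarith
    have hmm : U2min ≤ U2max := by
      rw [hU2min, hU2max]
      exact (minCh_le cU2 left_mem_channel).trans (le_maxCh cU2 left_mem_channel)
    have up1 : 0 ≤ U2max → c.re < Umax + 2 * U2max / κ := fun h => by
      refine lt_of_mul_lt_mul_right (hlt.trans_le ?_) hI.le
      have e : (Umax + 2 * U2max / κ) * I = Umax * I + U2max / 2 * (4 * I / κ) := by ring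
      rw [e]
      gcongr
    have up2 : U2max ≤ 0 → c.re < Umax := fun h => by
      refine lt_of_mul_lt_mul_right (hlt.trans_le ?_) hI.le
      nlinarith
    have lo1 : U2min ≤ 0 → Umin + 2 * U2min / κ < c.re := fun h => by
      refine lt_of_mul_lt_mul_right (lt_of_le_of_lt ?_ hgt) hI.le
      have e : (Umin + 2 * U2min / κ) * I = Umin * I + U2min / 2 * (4 * I / κ) := by ring
      rw [e]
      nlinarith
    have lo2 : 0 ≤ U2min → Umin < c.re := fun h => by
      refine lt_of_mul_lt_mul_right (lt_of_le_of_lt ?_ hgt) hI.le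
      nlinarith
    exact ⟨fun h => ⟨lo2 h, up1 (h.trans hmm)⟩, fun h h' => ⟨lo1 h, up1 h'⟩,
      fun h => ⟨lo1 (hmm.trans h), up2 h⟩⟩
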